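/- Let $(\mathcal N,\mathcal L)$ be a finite network with node set $\mathcal N$ and set of directed links $\mathcal L\subset\mathcal N\times\mathcal N$, and let $o,d\in\mathcal N$ be an origin and a destination such that there is a directed path from $o$ to $d$ (this holds in particular if the network is connected in the sense that there is a directed path from every node to every other node). Let $A\in\mathbb R^{\mathcal N\times\mathcal L}$ be the node-link incidence matrix (the column of link $ij$ has entry $-1$ at $i$, $+1$ at $j$ and $0$ elsewhere; the column of a self-loop, if any, is zero), and let $b\in\mathbb R^{\mathcal N}$ have entry $-1$ at $o$, $+1$ at $d$ and $0$ elsewhere ($b=0$ if $o=d$). For each link $ij$ let $F_{ij}:\mathbb R_+\to\mathbb R_+$ be twice continuously differentiable (one-sidedly at $0$), strictly convex and strictly increasing, with $F_{ij}(0)=F_{ij}'(0)=0$, $F_{ij}''(t)>0$ for all $t\ge 0$, and range equal to $\mathbb R_+$. Put $F(x)=\sum_{ij\in\mathcal L}F_{ij}(x_{ij})$ for $x\in\mathbb R_+^{\mathcal L}$, and let $\nabla^2F(x)$ be its Hessian, the diagonal matrix with entries $F_{ij}''(x_{ij})$. For a vector of positive link costs $c\in\mathbb R_{++}^{\mathcal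 L}$, let $x^*(c)$ be the minimizer of $c^\top x+F(x)$ subject to $Ax=b$, $x\ge 0$, and let $$W(-c)=\max_{Ax=b,\;x\ge 0}\{-x^\top c-F(x)\}.$$ Let $B^*=\mathrm{diag}(1_{\{x^*(c)>0\}})$ and $P^*=B^*-(AB^*)^+AB^*$, where $M^+$ is the Moore-Penrose inverse of $M$; that is, $P^*$ is the matrix of the orthogonal projection onto $\{x\in\mathbb R^{\mathcal L}: Ax=0,\ B^*x=x\}$. Let $$\mathcal C_0=\{c\in\mathbb R_{++}^{\mathcal L}: \text{the map } c'\mapsto 1_{\{x^*(c')>0\}}\in\{0,1\}^{\mathcal L} \text{ is not continuous at } c\}.$$ Then for every $c\in\mathbb R_{++}^{\mathcal L}$ the maximum $W(-c)$ is attained and the optimal flow $x^*(c)$ exists and is unique, and: 1. The value function $W$ is continuously differentiable on $\{-c: c\in\mathbb R_{++}^{\mathcal L}\}$ and satisfies $\nabla W(-c)=x^*(c)$ for all $c\in\mathbb R_{++}^{\mathcal L}$. In particular, $x^*$ is continuous on $\mathbb R_{++}^{\mathcal L}$. 2. $x^*$ is continuously differentiable on $\mathbb R_{++}^{\mathcal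 L}\setminus\mathcal C_0$, with symmetric negative semidefinite Jacobian $$\nabla x^*(c)=-\left(P^*\,\nabla^2F(x^*(c))\,P^*\right)^+ .$$ 3. $\mathcal C_0$ has Lebesgue measure zero. -/

import Mathlib

open scoped Matrix

noncomputable section

namespace PURC

section PseudoInverse

variable {m n : Type*} [Fintype m] [Fintype n]

/-- `X` is a Moore-Penrose inverse of the real matrix `M` (the four Penrose conditions). -/
structure IsMoorePenrose (M : Matrix m n ℝ) (X : Matrix n m ℝ) : Prop where
  mul_mul_self : M * X * M = M
  mul_mul_inv : X * M * X = X
  symm_left : (M * X)ᵀ = M * X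
  symm_right : (X * M)ᵀ = X * M

theorem IsMoorePenrose.unique {M : Matrix m n ℝ} {X Y : Matrix n m ℝ}
    (hX : IsMoorePenrose M X) (hY : IsMoorePenrose M Y) : X = Y := by
  have h1 : M * X = M * Y := by
    have h : M * X = (M * Y) * (M * X) := by
      rw [← Matrix.mul_assoc, hY.mul_mul_self]
    have h' : M * Y = (M * X) * (M * Y) := by
      rw [← Matrix.mul_assoc, hX.mul_mul_self]
    rw [← hX.symm_left, h, Matrix.transpose_mul, hX.symm_left, hY.symm_left, ← h']
  have h2 : X * M = Y * M := by
    have h : X * M = (X * M) * (Y * M) := by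
      rw [Matrix.mul_assoc, ← Matrix.mul_assoc M, hY.mul_mul_self]
    have h' : Y * M = (Y * M) * (X * M) := by
      rw [Matrix.mul_assoc, ← Matrix.mul_assoc M, hX.mul_mul_self]
    rw [← hX.symm_right, h, Matrix.transpose_mul, hX.symm_right, hY.symm_right, ← h']
  calc X = X * M * X := hX.mul_mul_inv.symm
    _ = Y * M * Y := by rw [h2, Matrix.mul_assoc, h1, ← Matrix.mul_assoc]
    _ = Y := hY.mul_mul_inv

theorem exists_isMoorePenrose (M : Matrix m n ℝ) : ∃ X, IsMoorePenrose M X := by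
  classical
  have hS : (Mᵀ * M).IsHermitian := by
    simpa using Matrix.isHermitian_conjTranspose_mul_self M
  obtain ⟨U, d, hU, hSd⟩ : ∃ (U : Matrix n n ℝ) (d : n → ℝ), Uᵀ * U = 1 ∧
      Mᵀ * M = U * Matrix.diagonal d * Uᵀ := by
    refine ⟨hS.eigenvectorUnitary, hS.eigenvalues, ?_, ?_⟩
    · simpa [Matrix.star_eq_conjTranspose] using
        Unitary.coe_star_mul_self hS.eigenvectorUnitary
    · simpa [Unitary.conjStarAlgAut_apply, Matrix.star_eq_conjTranspose, Function.comp_def]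
        using hS.spectral_theorem
  have key : ∀ a c : n → ℝ, (U * Matrix.diagonal a * Uᵀ) * (U * Matrix.diagonal c * Uᵀ) =
      U * Matrix.diagonal (fun i => a i * c i) * Uᵀ := by
    intro a c
    calc (U * Matrix.diagonal a * Uᵀ) * (U * Matrix.diagonal c * Uᵀ)
        = U * Matrix.diagonal a * (Uᵀ * U) * Matrix.diagonal c * Uᵀ := by
          simp only [Matrix.mul_assoc]
      _ = _ := by
          rw [hU, Matrix.mul_one, Matrix.mul_assoc U, Matrix.diagonal_mul_diagonal]
  have ksymm : ∀ a : n → ℝ, (U * Matrix.diagonal a * Uᵀ)ᵀ = U * Matrix.diagonal a * Uᵀ := by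
    intro a
    simp [Matrix.transpose_mul, Matrix.mul_assoc]
  set T : Matrix n n ℝ := U * Matrix.diagonal (fun i => (d i)⁻¹) * Uᵀ with hT
  have hTt : Tᵀ = T := ksymm _
  have hTSt : (T * (Mᵀ * M))ᵀ = T * (Mᵀ * M) := by
    rw [hSd, hT, key]; exact ksymm _
  have hTST : T * (Mᵀ * M) * T = T := by
    rw [hSd, hT, key, key]
    congr 3; funext i
    by_cases h : d i = 0 <;> simp [h]
  have hSTS : (Mᵀ * M) * (T * (Mᵀ * M)) = Mᵀ * M := by
    rw [hSd, hT, key, key]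
    congr 3; funext i
    by_cases h : d i = 0 <;> simp [h]
  refine ⟨T * Mᵀ, ?_, ?_, ?_, ?_⟩
  · have h : Mᴴ * M * (T * (Mᵀ * M) - 1) = 0 := by
      rw [Matrix.conjTranspose_eq_transpose_of_trivial, Matrix.mul_sub, hSTS, Matrix.mul_one,
        sub_self]
    rw [Matrix.conjTranspose_mul_self_mul_eq_zero, Matrix.mul_sub, Matrix.mul_one,
      sub_eq_zero] at h
    simpa only [Matrix.mul_assoc] using h
  · calc T * Mᵀ * M * (T * Mᵀ) = (T * (Mᵀ * M) * T) * Mᵀ := by simp only [Matrix.mul_assoc]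
      _ = T * Mᵀ := by rw [hTST]
  · simp [Matrix.transpose_mul, hTt, Matrix.mul_assoc]
  · rw [Matrix.mul_assoc]; exact hTSt

/-- The Moore-Penrose inverse of a real matrix. -/
def pinv (M : Matrix m n ℝ) : Matrix n m ℝ := (exists_isMoorePenrose M).choose

theorem pinv_spec (M : Matrix m n ℝ) : IsMoorePenrose M (pinv M) :=
  (exists_isMoorePenrose M).choose_spec

end PseudoInverse

/-- The assumptions on a link perturbation function `F : ℝ₊ → ℝ₊`. Only the values of `F` on
`[0, ∞)` matter; derivatives are those of the restriction to `[0, ∞)` (one-sided at `0`). -/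
structure IsPerturbation (F : ℝ → ℝ) : Prop where
  contDiffOn : ContDiffOn ℝ 2 F (Set.Ici 0)
  strictConvexOn : StrictConvexOn ℝ (Set.Ici 0) F
  strictMonoOn : StrictMonoOn F (Set.Ici 0)
  map_zero : F 0 = 0
  deriv_zero : derivWithin F (Set.Ici 0) 0 = 0
  deriv_deriv_pos : ∀ t ∈ Set.Ici (0 : ℝ),
    0 < derivWithin (derivWithin F (Set.Ici 0)) (Set.Ici 0) t
  range_eq : F '' Set.Ici 0 = Set.Ici 0

variable {N : Type*} [DecidableEq N]

/-- The node-link incidence matrix of the directed network with link set `links`; the link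
`e = (i, j)` goes from node `i` to node `j` (entry `-1` at `i` and `1` at `j`). -/
def incidence (links : Finset (N × N)) : Matrix N links ℝ :=
  fun v e => (if v = e.1.2 then 1 else 0) - (if v = e.1.1 then 1 else 0)

/-- The unit demand vector: `-1` at the origin `o` and `1` at the destination `d`. -/
def demand (o d : N) : N → ℝ :=
  fun v => (if v = d then 1 else 0) - (if v = o then 1 else 0)

/-- There is a directed path from `u` to `v`. -/
def Reachable (links : Finset (N × N)) (u v : N) : Prop :=
  Relation.ReflTransGen (fun i j => (i, j) ∈ links) u v

variable (links : Finset (N × N)) (o d : N) (F : links → ℝ → ℝ)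

/-- Nonnegative link flows satisfying flow conservation `A x = b`. -/
def feasible : Set (EuclideanSpace ℝ links) :=
  {x | incidence links *ᵥ x.ofLp = demand o d ∧ ∀ e, 0 ≤ x e}

/-- The total perturbation `F(x) = ∑ F_{ij}(x_{ij})`. -/
def totalF {links : Finset (N × N)} (F : links → ℝ → ℝ) (x : EuclideanSpace ℝ links) : ℝ :=
  ∑ e, F e (x e)

/-- The value function `W(v) = sup {xᵀ v - F(x) | A x = b, x ≥ 0}`. -/
def valueFn (v : EuclideanSpace ℝ links) : ℝ :=
  sSup ((fun x : EuclideanSpace ℝ links => ∑ e, x e * v e - totalF F x) '' feasible links o d)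

/-- `x` minimizes the perturbed cost `cᵀ x + F(x)` over the feasible flows. -/
def IsOptimal (c x : EuclideanSpace ℝ links) : Prop :=
  IsMinOn (fun y : EuclideanSpace ℝ links => ∑ e, c e * y e + totalF F y) (feasible links o d) x
    ∧ x ∈ feasible links o d

open Classical in
/-- The optimal flow `x*(c)` (with value `0` if there is no optimal flow). -/
def optFlow (c : EuclideanSpace ℝ links) : EuclideanSpace ℝ links :=
  if h : ∃ x, IsOptimal links o d F c x then h.choose else 0

/-- The positive link cost vectors. -/
def posCosts : Set (EuclideanSpace ℝ links) := {c | ∀ e, 0 < c e}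

open Classical in
/-- The indicator vector `1_{x > 0}` of the active links. -/
def activeIndicator {links : Finset (N × N)} (x : EuclideanSpace ℝ links) : links → ℝ :=
  fun e => if 0 < x e then 1 else 0

/-- The activation boundary `C₀`: the cost vectors at which `c ↦ 1_{x*(c) > 0}` is
discontinuous. -/
def activationBoundary : Set (EuclideanSpace ℝ links) :=
  {c ∈ posCosts links | ¬ ContinuousAt (fun c' => activeIndicator (optFlow links o d F c')) c}

/-- `B = diag(1_{x > 0})`. -/
def activeMatrix {links : Finset (N × N)} (x : EuclideanSpace ℝ links) :
    Matrix links links ℝ :=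
  Matrix.diagonal (activeIndicator x)

/-- `P = B - (A B)⁺ A B` for the flow `x`: the orthogonal projection onto
`{y | A y = 0, B y = y}`. -/
def projMatrix [Fintype N] {links : Finset (N × N)} (x : EuclideanSpace ℝ links) :
    Matrix links links ℝ :=
  activeMatrix x - pinv (incidence links * activeMatrix x) * (incidence links * activeMatrix x)

/-- The Hessian `∇²F(x)` of the separable function `F(x) = ∑ F_{ij}(x_{ij})` on the nonnegative
orthant: the diagonal matrix with entries `F''_{ij}(x_{ij})`. -/
def hessF {links : Finset (N × N)} (F : links → ℝ → ℝ) (x : EuclideanSpace ℝ links) :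
    Matrix links links ℝ :=
  Matrix.diagonal fun e => derivWithin (derivWithin (F e) (Set.Ici 0)) (Set.Ici 0) (x e)

/-- The matrix `-(P* ∇²F(x*) P*)⁺` at `x* = x*(c)`. -/
def jacobianMatrix [Fintype N] (c : EuclideanSpace ℝ links) : Matrix links links ℝ :=
  -pinv (projMatrix (optFlow links o d F c) * hessF F (optFlow links o d F c) *
    projMatrix (optFlow links o d F c))

end PURC

end

/-! Everything rests on the variational inequality: at an optimal flow `x` for costs `c`, the vector
`c + F'(x)` has nonnegative inner product with `y - x` for every feasible `y`. On bounded intervals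
`F'` is strongly monotone, because `F''` is continuous and positive there. Adding the inequalities
at two optimal flows therefore bounds the change in flow by a multiple of the change in cost
(`exists_lipschitz_of_bounded`). This gives uniqueness at once. Positive costs bound the optimal
flows locally, so `x*` is locally Lipschitz (`exists_lipschitz_optFlow`). The value function is a
supremum of affine functions of the cost, and `x*(c)` is a subgradient at `-c`. Continuity of this
subgradient turns it into a gradient (`hasGradientAt_valueFn`). Off the activation boundary the set
of active links is locally constant, so nearby optimal flows differ by circulations on a fixed set
of links, that is, by vectors in the range of `P*`. Projecting the first-order conditions onto this
range and linearizing `F'` expresses `x' - x` as `-(P* ∇²F P*)⁺ (c' - c)` plus an error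
(`IsOptimal.sub_eq`). The Lipschitz bound makes the error `o(c' - c)`. With `P*` fixed, the
pseudoinverse reduces to an ordinary inverse (`pinv_compression_eq`), whence the Jacobian is
continuous. For the null set, a discontinuity requires some unused link `e` to become active under
arbitrarily small cost changes. Raising the cost of `e` alone leaves the flow unchanged and makes
`e` stay unused nearby (`eventually_optFlow_add_single_eq_zero`). Each line parallel to the `e`-axis
thus meets the bad set of `e` at most once, and a measurable set with this property is null. -/

noncomputable section

namespace PURC

open Set Filter Topology MeasureTheory

/-! ### Pseudoinverses of compressions `P D P` of a positive diagonal matrix. -/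

section PseudoInverse

variable {n : Type*} [Fintype n]

theorem IsMoorePenrose.transpose {m : Type*} [Fintype m] {M : Matrix m n ℝ} {X : Matrix n m ℝ}
    (h : IsMoorePenrose M X) : IsMoorePenrose Mᵀ Xᵀ where
  mul_mul_self := by
    rw [← Matrix.transpose_mul, ← Matrix.transpose_mul, ← Matrix.mul_assoc, h.mul_mul_self]
  mul_mul_inv := by
    rw [← Matrix.transpose_mul, ← Matrix.transpose_mul, ← Matrix.mul_assoc, h.mul_mul_inv]
  symm_left := by rw [← Matrix.transpose_mul, h.symm_right, h.symm_right]
  symm_right := by rw [← Matrix.transpose_mul, h.symm_left, h.symm_left]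

theorem pinv_transpose_of_symm {M : Matrix n n ℝ} (hM : Mᵀ = M) : (pinv M)ᵀ = pinv M := by
  have h := (pinv_spec M).transpose
  rw [hM] at h
  exact h.unique (pinv_spec M)

variable [DecidableEq n]

/-- If a positive diagonal form vanishes on the columns of `X`, so does `X`. -/
theorem eq_zero_of_transpose_mul_diagonal_mul {h : n → ℝ} (hh : ∀ i, 0 < h i)
    {X : Matrix n n ℝ} (hX : Xᵀ * Matrix.diagonal h * X = 0) : X = 0 := by
  ext i j
  have h1 : ∑ k, h k * X k j ^ 2 = 0 := by
    have h2 := congrFun (congrFun hX j) j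
    rw [Matrix.mul_apply] at h2
    simp only [Matrix.mul_diagonal, Matrix.transpose_apply, Matrix.zero_apply] at h2
    rw [← h2]
    exact Finset.sum_congr rfl fun k _ => by ring
  have h3 := (Finset.sum_eq_zero_iff_of_nonneg
    (fun k _ => mul_nonneg (hh k).le (sq_nonneg (X k j)))).1 h1 i (Finset.mem_univ _)
  simpa [(hh i).ne'] using h3

section Compression

variable {P : Matrix n n ℝ} (hPt : Pᵀ = P) (hPP : P * P = P) {h : n → ℝ}

include hPt in
theorem compression_transpose :
    (P * Matrix.diagonal h * P)ᵀ = P * Matrix.diagonal h * P := by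
  simp [Matrix.transpose_mul, hPt, Matrix.mul_assoc]

-- The identity `M⁺ = M⁺ M M⁺` with `M⁺` symmetric exhibits `M⁺` as a congruence transform of the
-- positive semidefinite `M`.
include hPt in
theorem pinv_compression_posSemidef (hh : ∀ i, 0 < h i) :
    (pinv (P * Matrix.diagonal h * P)).PosSemidef := by
  have hM : (P * Matrix.diagonal h * P).PosSemidef := by
    have := (Matrix.PosSemidef.diagonal (fun i => (hh i).le)).conjTranspose_mul_mul_same P
    rwa [Matrix.conjTranspose_eq_transpose_of_trivial, hPt] at this
  have := hM.conjTranspose_mul_mul_same (pinv (P * Matrix.diagonal h * P))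
  rwa [Matrix.conjTranspose_eq_transpose_of_trivial,
    pinv_transpose_of_symm (compression_transpose hPt), (pinv_spec _).mul_mul_inv] at this

include hPt hPP

/-- For symmetric `M` the Penrose conditions give `M⁺ = M (M⁺ M⁺)`, so the range of `M⁺` lies in
that of `M`, hence in that of `P`. -/
theorem mul_pinv_compression :
    P * pinv (P * Matrix.diagonal h * P) = pinv (P * Matrix.diagonal h * P) := by
  set M := P * Matrix.diagonal h * P with hM
  have hMt : Mᵀ = M := compression_transpose hPt
  have hYt : (pinv M)ᵀ = pinv M := pinv_transpose_of_symm hMt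
  have hPM : P * M = M := by
    rw [hM, ← Matrix.mul_assoc, ← Matrix.mul_assoc, hPP]
  have h1 : pinv M = M * (pinv M * pinv M) := by
    have h2 := (pinv_spec M).symm_right
    rw [Matrix.transpose_mul, hMt, hYt] at h2
    rw [← Matrix.mul_assoc, h2, (pinv_spec M).mul_mul_inv]
  rw [h1, ← Matrix.mul_assoc, hPM]

theorem pinv_compression_mul :
    pinv (P * Matrix.diagonal h * P) * P = pinv (P * Matrix.diagonal h * P) := by
  have h1 := congrArg Matrix.transpose (mul_pinv_compression hPt hPP (h := h))
  rwa [Matrix.transpose_mul, hPt, pinv_transpose_of_symm (compression_transpose hPt)] at h1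

/-- Positivity of the diagonal makes `M` injective on the range of `P`. Concretely, `Z = P - M M⁺`
satisfies `Z M = 0`, so the positive form vanishes on `P Zᵀ`. Hence `Z P = 0`, which is the claim
because `M⁺ P = M⁺`. -/
theorem compression_mul_pinv (hh : ∀ i, 0 < h i) :
    P * Matrix.diagonal h * P * pinv (P * Matrix.diagonal h * P) = P := by
  set M := P * Matrix.diagonal h * P with hM
  have hMt : Mᵀ = M := compression_transpose hPt
  have hPM : P * M = M := by
    rw [hM, ← Matrix.mul_assoc, ← Matrix.mul_assoc, hPP]
  set Z := P - M * pinv M with hZ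
  have hZM : Z * M = 0 := by
    rw [hZ, Matrix.sub_mul, hPM, (pinv_spec M).mul_mul_self, sub_self]
  have hZP : P * Zᵀ = 0 := by
    refine eq_zero_of_transpose_mul_diagonal_mul hh ?_
    rw [Matrix.transpose_mul, Matrix.transpose_transpose, hPt]
    calc Z * P * Matrix.diagonal h * (P * Zᵀ) = Z * M * Zᵀ := by
          rw [hM]; simp only [Matrix.mul_assoc]
      _ = 0 := by rw [hZM, Matrix.zero_mul]
  have h1 : Z * P = 0 := by
    have := congrArg Matrix.transpose hZP
    rwa [Matrix.transpose_mul, Matrix.transpose_transpose, hPt, Matrix.transpose_zero] at this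
  rw [hZ, Matrix.sub_mul, hPP, Matrix.mul_assoc, pinv_compression_mul hPt hPP, ← hM] at h1
  exact (sub_eq_zero.1 h1).symm

theorem pinv_mul_compression (hh : ∀ i, 0 < h i) :
    pinv (P * Matrix.diagonal h * P) * (P * Matrix.diagonal h * P) = P := by
  have h1 := congrArg Matrix.transpose (compression_mul_pinv hPt hPP hh)
  rwa [Matrix.transpose_mul, hPt, compression_transpose hPt,
    pinv_transpose_of_symm (compression_transpose hPt)] at h1

/-- Adding `1 - P` fills in the complementary block with the identity. The two blocks do not
interact, so the pseudoinverse becomes part of a true inverse. -/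
theorem compression_add_mul_pinv_add (hh : ∀ i, 0 < h i) :
    (P * Matrix.diagonal h * P + (1 - P)) * (pinv (P * Matrix.diagonal h * P) + (1 - P)) = 1 := by
  have h1 : P * Matrix.diagonal h * P * (1 - P) = 0 := by
    rw [Matrix.mul_assoc, Matrix.mul_sub, hPP, Matrix.mul_one, sub_self, Matrix.mul_zero]
  have h2 : (1 - P) * pinv (P * Matrix.diagonal h * P) = 0 := by
    rw [Matrix.sub_mul, mul_pinv_compression hPt hPP, Matrix.one_mul, sub_self]
  have h3 : (1 - P) * (1 - P) = 1 - P := by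
    rw [Matrix.sub_mul, Matrix.mul_sub P, hPP, Matrix.mul_one, sub_self, sub_zero, Matrix.one_mul]
  rw [Matrix.add_mul, Matrix.mul_add, Matrix.mul_add, compression_mul_pinv hPt hPP hh, h1, h2, h3]
  simp

theorem pinv_compression_eq (hh : ∀ i, 0 < h i) :
    pinv (P * Matrix.diagonal h * P) = (P * Matrix.diagonal h * P + (1 - P))⁻¹ - (1 - P) := by
  rw [Matrix.inv_eq_right_inv (compression_add_mul_pinv_add hPt hPP hh), add_sub_cancel_right]

/-- The Moore-Penrose inverse is not continuous in general, since the rank may jump. Here `P` is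
fixed and the diagonal positive, so the formula through an ordinary inverse applies. -/
theorem continuousOn_pinv_compression {α : Type*} [TopologicalSpace α] {s : Set α}
    {k : α → n → ℝ} (hk : ContinuousOn k s) (hpos : ∀ a ∈ s, ∀ i, 0 < k a i) :
    ContinuousOn (fun a => pinv (P * Matrix.diagonal (k a) * P)) s := by
  have h1 : ContinuousOn
      (fun a => (P * Matrix.diagonal (k a) * P + (1 - P))⁻¹ - (1 - P)) s := by
    have hQ : ContinuousOn (fun a => P * Matrix.diagonal (k a) * P + (1 - P)) s := by
      have : Continuous fun v : n → ℝ => P * Matrix.diagonal v * P + (1 - P) := by fun_prop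
      exact this.comp_continuousOn hk
    refine ContinuousOn.sub ?_ continuousOn_const
    simp only [Matrix.inv_def, Ring.inverse_eq_inv']
    have hdet : Continuous fun A : Matrix n n ℝ => A.det := continuous_id.matrix_det
    have hadj : Continuous fun A : Matrix n n ℝ => A.adjugate := continuous_id.matrix_adjugate
    refine ContinuousOn.smul ((hdet.comp_continuousOn hQ).inv₀ fun a ha h0 => ?_)
      (hadj.comp_continuousOn hQ)
    have h2 := congrArg Matrix.det (compression_add_mul_pinv_add hPt hPP (hpos a ha))
    rw [Function.comp_apply] at h0
    rw [Matrix.det_mul, h0] at h2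
    simp at h2
  exact h1.congr fun a ha => pinv_compression_eq hPt hPP (hpos a ha)

end Compression

end PseudoInverse

/-! ### The projection onto circulations supported on active links. -/

section Projection

variable {N : Type*} [DecidableEq N] {links : Finset (N × N)}
  (x : EuclideanSpace ℝ links)

theorem activeMatrix_transpose : (activeMatrix x)ᵀ = activeMatrix x :=
  Matrix.diagonal_transpose _

theorem activeMatrix_mul_self : activeMatrix x * activeMatrix x = activeMatrix x := by
  rw [activeMatrix, Matrix.diagonal_mul_diagonal]
  congr 1
  funext e
  simp [activeIndicator]

variable [Fintype N]

/-- The range of `M⁺` is contained in that of `Mᵀ = B Aᵀ`, on which `B` acts as the identity. -/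
theorem activeMatrix_mul_pinv :
    activeMatrix x * pinv (incidence links * activeMatrix x) =
      pinv (incidence links * activeMatrix x) := by
  set M := incidence links * activeMatrix x with hM
  have h1 : pinv M = activeMatrix x * ((incidence links)ᵀ * (pinv M)ᵀ * pinv M) := by
    have h2 := (pinv_spec M).symm_right
    have h3 : Mᵀ = activeMatrix x * (incidence links)ᵀ := by
      rw [hM, Matrix.transpose_mul, activeMatrix_transpose]
    rw [Matrix.transpose_mul, h3] at h2
    conv_lhs => rw [← (pinv_spec M).mul_mul_inv, ← h2]
    simp only [Matrix.mul_assoc]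
  conv_lhs => rw [h1, ← Matrix.mul_assoc, activeMatrix_mul_self]
  exact h1.symm

theorem activeMatrix_mul_projMatrix : activeMatrix x * projMatrix x = projMatrix x := by
  rw [projMatrix, Matrix.mul_sub, activeMatrix_mul_self, ← Matrix.mul_assoc (activeMatrix x),
    activeMatrix_mul_pinv]

theorem incidence_mul_activeMatrix_mul_projMatrix :
    incidence links * activeMatrix x * projMatrix x = 0 := by
  rw [projMatrix, Matrix.mul_sub, ← Matrix.mul_assoc _ (pinv _), (pinv_spec _).mul_mul_self,
    Matrix.mul_assoc, activeMatrix_mul_self, sub_self]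

theorem incidence_mul_projMatrix : incidence links * projMatrix x = 0 := by
  rw [← activeMatrix_mul_projMatrix, ← Matrix.mul_assoc,
    incidence_mul_activeMatrix_mul_projMatrix]

theorem projMatrix_transpose : (projMatrix x)ᵀ = projMatrix x := by
  rw [projMatrix, Matrix.transpose_sub, (pinv_spec _).symm_right, activeMatrix_transpose]

theorem projMatrix_mul_self : projMatrix x * projMatrix x = projMatrix x := by
  conv_lhs => enter [1]; rw [projMatrix]
  rw [Matrix.sub_mul, activeMatrix_mul_projMatrix, Matrix.mul_assoc,
    incidence_mul_activeMatrix_mul_projMatrix, Matrix.mul_zero, sub_zero]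

/-- Together with symmetry, idempotence, `B P = P` and `A P = 0`, this identifies `P` as the
orthogonal projection onto circulations on active links. -/
theorem projMatrix_mulVec_eq_self {z : links → ℝ} (hA : incidence links *ᵥ z = 0)
    (hB : activeMatrix x *ᵥ z = z) : projMatrix x *ᵥ z = z := by
  rw [projMatrix, Matrix.sub_mulVec, hB, ← Matrix.mulVec_mulVec, ← Matrix.mulVec_mulVec, hB, hA,
    Matrix.mulVec_zero, sub_zero]

theorem projMatrix_congr {y : EuclideanSpace ℝ links} (h : activeIndicator x = activeIndicator y) :
    projMatrix x = projMatrix y := by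
  simp only [projMatrix, activeMatrix, h]

end Projection

section OptimalFlow

/-! ### Perturbation functions -/

/-- The marginal perturbation cost `F'` on `[0, ∞)`. -/
abbrev marginal (f : ℝ → ℝ) : ℝ → ℝ := derivWithin f (Ici 0)

namespace IsPerturbation

variable {f : ℝ → ℝ} (hf : IsPerturbation f)
include hf

theorem continuousOn : ContinuousOn f (Ici 0) := hf.contDiffOn.continuousOn

theorem nonneg {t : ℝ} (ht : 0 ≤ t) : 0 ≤ f t := by
  have : f t ∈ f '' Ici 0 := ⟨t, ht, rfl⟩
  rwa [hf.range_eq] at this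

theorem hasDerivWithinAt {t : ℝ} (ht : 0 ≤ t) : HasDerivWithinAt f (marginal f t) (Ici 0) t :=
  (hf.contDiffOn.differentiableOn (by norm_num) t ht).hasDerivWithinAt

theorem contDiffOn_marginal : ContDiffOn ℝ 1 (marginal f) (Ici 0) :=
  hf.contDiffOn.derivWithin (uniqueDiffOn_Ici 0) (by norm_num)

theorem continuousOn_marginal : ContinuousOn (marginal f) (Ici 0) :=
  hf.contDiffOn_marginal.continuousOn

theorem hasDerivWithinAt_marginal {t : ℝ} (ht : 0 ≤ t) :
    HasDerivWithinAt (marginal f) (derivWithin (marginal f) (Ici 0) t) (Ici 0) t :=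
  (hf.contDiffOn_marginal.differentiableOn (by norm_num) t ht).hasDerivWithinAt

theorem continuousOn_deriv_marginal : ContinuousOn (derivWithin (marginal f) (Ici 0)) (Ici 0) :=
  hf.contDiffOn_marginal.continuousOn_derivWithin (uniqueDiffOn_Ici 0) le_rfl

/-- The marginal cost is strongly monotone on bounded intervals. -/
theorem exists_strongly_monotone (R : ℝ) :
    ∃ m > 0, ∀ s ∈ Icc 0 R, ∀ t ∈ Icc 0 R,
      m * (t - s) ^ 2 ≤ (marginal f t - marginal f s) * (t - s) := by
  rcases (Icc (0 : ℝ) R).eq_empty_or_nonempty with h0 | hne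
  · exact ⟨1, one_pos, by simp [h0]⟩
  have hsub : Icc (0 : ℝ) R ⊆ Ici 0 := Icc_subset_Ici_self
  -- The constant is the minimum of `F''` on the interval, attained by compactness and hence
  -- positive.
  obtain ⟨r, hr, hmin⟩ := isCompact_Icc.exists_isMinOn hne
    (hf.continuousOn_deriv_marginal.mono hsub)
  set m := derivWithin (marginal f) (Ici 0) r with hm
  have hmv : ∀ s ∈ Icc 0 R, ∀ t ∈ Icc 0 R, s ≤ t → m * (t - s) ≤ marginal f t - marginal f s := by
    refine (convex_Icc 0 R).mul_sub_le_image_sub_of_le_deriv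
      (hf.continuousOn_marginal.mono hsub) ?_ ?_
    · exact (hf.contDiffOn_marginal.differentiableOn (by norm_num)).mono
        (interior_subset.trans hsub)
    · intro t ht
      have ht0 : 0 < t := by rw [interior_Icc] at ht; exact ht.1
      rw [← derivWithin_of_mem_nhds (Ici_mem_nhds ht0)]
      exact hmin (interior_subset ht)
  refine ⟨m, hf.deriv_deriv_pos r (hsub hr), fun s hs t ht => ?_⟩
  rcases le_total s t with h | h
  · nlinarith [hmv s hs t ht h]
  · nlinarith [hmv t ht s hs h]

end IsPerturbation

variable {N : Type*} {links : Finset (N × N)} {F : links → ℝ → ℝ}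

theorem exists_pos_lt_of_mem_posCosts {c : EuclideanSpace ℝ links} (hc : c ∈ posCosts links) :
    ∃ δ > 0, ∀ e, δ < c e := by
  rcases isEmpty_or_nonempty links with h | h
  · exact ⟨1, one_pos, fun e => h.elim e⟩
  · obtain ⟨e₀, he₀⟩ := Finite.exists_min fun e => c e
    exact ⟨c e₀ / 2, half_pos (hc e₀), fun e => (half_lt_self (hc e₀)).trans_le (he₀ e)⟩

theorem isOpen_posCosts : IsOpen (posCosts links) := by
  simp only [posCosts, ofPred_forall]
  exact isOpen_iInter_of_finite fun e => isOpen_lt continuous_const (by fun_prop)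

theorem activeIndicator_eq_iff {x y : EuclideanSpace ℝ links} :
    activeIndicator x = activeIndicator y ↔ ∀ e, 0 < x e ↔ 0 < y e := by
  refine ⟨fun h e => ?_, fun h => ?_⟩
  · have := congrFun h e
    unfold activeIndicator at this
    by_cases h1 : 0 < x e <;> by_cases h2 : 0 < y e <;> simp [h1, h2] at this ⊢
  · funext e
    simp [activeIndicator, h e]

/-! ### The total perturbation and the a priori bound on flows. -/

section TotalPerturbation

variable (hF : ∀ e, IsPerturbation (F e))
include hF

theorem continuousOn_totalF : ContinuousOn (totalF F) {x | ∀ e, 0 ≤ x e} := by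
  refine continuousOn_finsetSum _ fun e _ => ?_
  exact (hF e).continuousOn.comp (by fun_prop) fun x hx => hx e

theorem totalF_nonneg {x : EuclideanSpace ℝ links} (hx : ∀ e, 0 ≤ x e) : 0 ≤ totalF F x :=
  Finset.sum_nonneg fun e _ => (hF e).nonneg (hx e)

/-- A priori bound: costs bounded below control flows with bounded perturbed cost. -/
theorem flow_le_of_cost_le {c x : EuclideanSpace ℝ links} {δ C : ℝ} (hδ : 0 < δ)
    (hc : ∀ e, δ ≤ c e) (hx : ∀ e, 0 ≤ x e) (h : ∑ e, c e * x e + totalF F x ≤ C) (e : links) :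
    x e ≤ C / δ := by
  rw [le_div_iff₀ hδ]
  have h1 : c e * x e ≤ ∑ e, c e * x e :=
    Finset.single_le_sum (f := fun e => c e * x e)
      (fun i _ => mul_nonneg (hδ.le.trans (hc i)) (hx i)) (Finset.mem_univ e)
  nlinarith [totalF_nonneg hF hx, mul_le_mul_of_nonneg_right (hc e) (hx e)]

theorem hessF_pos {x : EuclideanSpace ℝ links}
    (hx : ∀ e, 0 ≤ x e) (e : links) : 0 < derivWithin (marginal (F e)) (Ici 0) (x e) :=
  (hF e).deriv_deriv_pos _ (hx e)

end TotalPerturbation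

variable [DecidableEq N] {o d : N}

/-! ### Feasible flows -/

/-- A unit of flow is sent along the path, one link at a time. The columns of the incidence matrix
telescope, and repeated links merely accumulate flow. -/
theorem nonempty_feasible (hpath : Reachable links o d) : (feasible links o d).Nonempty := by
  induction hpath with
  | refl => exact ⟨0, by funext v; simp [demand], fun e => le_rfl⟩
  | @tail u v _ huv ih =>
    obtain ⟨x, hx, hx0⟩ := ih
    refine ⟨x + EuclideanSpace.single ⟨(u, v), huv⟩ 1, ?_, fun e => ?_⟩
    · rw [WithLp.ofLp_add, Matrix.mulVec_add, hx]
      funext w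
      simp [demand, incidence]
    · have : (0 : ℝ) ≤ EuclideanSpace.single (⟨(u, v), huv⟩ : links) (1 : ℝ) e := by
        rw [PiLp.single_apply]; split_ifs <;> norm_num
      simpa using add_nonneg (hx0 e) this

theorem continuous_incidence_mulVec :
    Continuous fun x : EuclideanSpace ℝ links => incidence links *ᵥ x.ofLp := by
  fun_prop

theorem isClosed_feasible : IsClosed (feasible links o d) := by
  have h1 : IsClosed {x : EuclideanSpace ℝ links | incidence links *ᵥ x.ofLp = demand o d} :=
    isClosed_eq continuous_incidence_mulVec continuous_const
  have h2 : IsClosed {x : EuclideanSpace ℝ links | ∀ e, 0 ≤ x e} := by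
    simp only [ofPred_forall]
    exact isClosed_iInter fun e => isClosed_le continuous_const (by fun_prop)
  exact h1.inter h2

theorem convex_feasible : Convex ℝ (feasible links o d) := by
  rintro x ⟨hx, hx0⟩ y ⟨hy, hy0⟩ a b ha hb hab
  refine ⟨?_, fun e => ?_⟩
  · rw [WithLp.ofLp_add, WithLp.ofLp_smul, WithLp.ofLp_smul, Matrix.mulVec_add, Matrix.mulVec_smul,
      Matrix.mulVec_smul, hx, hy, ← add_smul, hab, one_smul]
  · exact add_nonneg (mul_nonneg ha (hx0 e)) (mul_nonneg hb (hy0 e))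

/-- Moving a feasible flow along a circulation supported on its active links keeps it feasible. -/
theorem eventually_add_smul_mem_feasible {x z : EuclideanSpace ℝ links}
    (hx : x ∈ feasible links o d) (hz : incidence links *ᵥ z.ofLp = 0)
    (hsupp : ∀ e, x e = 0 → 0 ≤ z e) : ∀ᶠ s : ℝ in 𝓝[>] 0, x + s • z ∈ feasible links o d := by
  have h1 : ∀ e, ∀ᶠ s : ℝ in 𝓝[>] 0, 0 ≤ x e + s * z e := by
    intro e
    rcases (hx.2 e).eq_or_lt with h | h
    · filter_upwards [self_mem_nhdsWithin] with s hs
      rw [← h, zero_add]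
      exact mul_nonneg (le_of_lt hs) (hsupp e h.symm)
    · have : Tendsto (fun s : ℝ => x e + s * z e) (𝓝 0) (𝓝 (x e)) := by
        have : Continuous fun s : ℝ => x e + s * z e := by fun_prop
        simpa using this.tendsto 0
      exact ((this.eventually (lt_mem_nhds h)).mono fun s hs => hs.le).filter_mono
        nhdsWithin_le_nhds
  filter_upwards [eventually_all.2 h1] with s hs
  refine ⟨?_, hs⟩
  rw [WithLp.ofLp_add, WithLp.ofLp_smul, Matrix.mulVec_add, Matrix.mulVec_smul, hz, hx.1,
    smul_zero, add_zero]

/-! ### Existence and characterization of optimal flows -/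

section Perturbation

variable (hF : ∀ e, IsPerturbation (F e))
include hF

/-- Costs bounded below by some `δ > 0` make the objective coercive on the orthant: a flow no more
expensive than a reference flow lies in a compact box. -/
theorem exists_isOptimal (hpath : Reachable links o d) {c : EuclideanSpace ℝ links}
    (hc : c ∈ posCosts links) : ∃ x, IsOptimal links o d F c x := by
  obtain ⟨x₀, hx₀⟩ := nonempty_feasible hpath
  obtain ⟨δ, hδ, hδc⟩ := exists_pos_lt_of_mem_posCosts hc
  set J : EuclideanSpace ℝ links → ℝ := fun y => ∑ e, c e * y e + totalF F y with hJ
  have hcont : ContinuousOn J (feasible links o d) := by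
    refine ContinuousOn.add (by fun_prop) ((continuousOn_totalF hF).mono fun x hx => hx.2)
  set K : Set (EuclideanSpace ℝ links) :=
    {x | ∀ e, x e ∈ Icc (-(J x₀ / δ)) (J x₀ / δ)} with hK
  have hKc : IsCompact K := by
    have : K = (EuclideanSpace.equiv links ℝ).toHomeomorph ⁻¹'
        (Set.pi univ fun _ => Icc (-(J x₀ / δ)) (J x₀ / δ)) := by
      ext x
      exact ⟨fun h e _ => h e, fun h e => h e trivial⟩
    rw [this, Homeomorph.isCompact_preimage]
    exact isCompact_univ_pi fun _ => isCompact_Icc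
  obtain ⟨x, hx, hmin⟩ := hcont.exists_isMinOn' isClosed_feasible hx₀ (by
    rw [eventually_inf_principal]
    filter_upwards [hKc.compl_mem_cocompact] with x hxK hx
    by_contra! hlt
    refine hxK fun e => ?_
    have h1 := flow_le_of_cost_le hF hδ (fun e => (hδc e).le) hx.2 hlt.le e
    exact ⟨by linarith [hx.2 e], h1⟩)
  exact ⟨x, hmin, hx⟩

/-- The variational inequality satisfied by an optimal flow. -/
theorem IsOptimal.variational {c x y : EuclideanSpace ℝ links} (hx : IsOptimal links o d F c x)
    (hy : y ∈ feasible links o d) : 0 ≤ ∑ e, (c e + marginal (F e) (x e)) * (y e - x e) := by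
  let p : links → EuclideanSpace ℝ links →L[ℝ] ℝ := fun e => EuclideanSpace.proj e
  have hproj : ∀ e : links, HasFDerivWithinAt (fun y : EuclideanSpace ℝ links => y e)
      (p e) (feasible links o d) x := fun e => (p e).hasFDerivWithinAt
  have h1 : HasFDerivWithinAt (fun y : EuclideanSpace ℝ links => ∑ e, c e * y e + totalF F y)
      (∑ e, c e • p e + ∑ e, marginal (F e) (x e) • p e) (feasible links o d) x := by
    -- Only derivatives within the feasible set are available, since each link function is
    -- controlled on `[0, ∞)` alone.
    refine HasFDerivWithinAt.add (HasFDerivWithinAt.fun_sum fun e _ => (hproj e).const_mul (c e)) ?_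
    exact HasFDerivWithinAt.fun_sum fun e _ =>
      ((hF e).hasDerivWithinAt (hx.2.2 e)).comp_hasFDerivWithinAt x (hproj e) fun z hz => hz.2 e
  have h2 := hx.1.localize.hasFDerivWithinAt_nonneg h1
    (sub_mem_posTangentConeAt_of_segment_subset (convex_feasible.segment_subset hx.2 hy))
  simpa [p, add_mul, Finset.sum_add_distrib] using h2

/-- The variational inequality in any direction that leads to feasible flows. -/
theorem IsOptimal.variational_of_eventually {c x z : EuclideanSpace ℝ links}
    (hx : IsOptimal links o d F c x) (hz : ∀ᶠ s : ℝ in 𝓝[>] 0, x + s • z ∈ feasible links o d) :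
    0 ≤ ∑ e, (c e + marginal (F e) (x e)) * z e := by
  obtain ⟨s, hs, hs0⟩ := (hz.and self_mem_nhdsWithin).exists
  have h1 := hx.variational hF hs
  have h2 : ∑ e, (c e + marginal (F e) (x e)) * ((x + s • z) e - x e) =
      s * ∑ e, (c e + marginal (F e) (x e)) * z e := by
    rw [Finset.mul_sum]
    exact Finset.sum_congr rfl fun e _ => by simp; ring
  rw [h2] at h1
  exact nonneg_of_mul_nonneg_right h1 hs0

/-- Optimal flows in a bounded region depend Lipschitz-continuously on the costs. -/
theorem exists_lipschitz_of_bounded (R : ℝ) : ∃ m > 0, ∀ c c' x x' : EuclideanSpace ℝ links,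
    IsOptimal links o d F c x → IsOptimal links o d F c' x' → (∀ e, x e ≤ R) → (∀ e, x' e ≤ R) →
      m * ‖x' - x‖ ≤ ‖c' - c‖ := by
  choose m hm hmono using fun e => (hF e).exists_strongly_monotone R
  obtain ⟨m₀, hm₀, hle⟩ : ∃ m₀ > 0, ∀ e, m₀ ≤ m e := by
    rcases isEmpty_or_nonempty links with h | h
    · exact ⟨1, one_pos, fun e => h.elim e⟩
    · obtain ⟨e₀, he₀⟩ := Finite.exists_min m
      exact ⟨m e₀, hm e₀, he₀⟩
  refine ⟨m₀, hm₀, fun c c' x x' hx hx' hR hR' => ?_⟩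
  have h1 := hx.variational hF hx'.2
  have h2 := hx'.variational hF hx.2
  have h3 : m₀ * ‖x' - x‖ ^ 2 ≤
      ∑ e, (marginal (F e) (x' e) - marginal (F e) (x e)) * (x' e - x e) := by
    rw [EuclideanSpace.norm_sq_eq, Finset.mul_sum]
    refine Finset.sum_le_sum fun e _ => ?_
    have := hmono e (x e) ⟨hx.2.2 e, hR e⟩ (x' e) ⟨hx'.2.2 e, hR' e⟩
    rw [Real.norm_eq_abs, sq_abs, PiLp.sub_apply]
    exact (mul_le_mul_of_nonneg_right (hle e) (sq_nonneg _)).trans this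
  -- Both subtracted sums are nonnegative by the two variational inequalities, so the monotonicity
  -- gap is at most the inner product, which Cauchy-Schwarz bounds.
  have h4 : ∑ e, (marginal (F e) (x' e) - marginal (F e) (x e)) * (x' e - x e) =
      inner ℝ (c - c') (x' - x) - ∑ e, (c e + marginal (F e) (x e)) * (x' e - x e)
        - ∑ e, (c' e + marginal (F e) (x' e)) * (x e - x' e) := by
    simp only [PiLp.inner_apply, PiLp.sub_apply]
    rw [← Finset.sum_sub_distrib, ← Finset.sum_sub_distrib]
    exact Finset.sum_congr rfl fun e _ => by simp; ring
  have h5 : inner ℝ (c - c') (x' - x) ≤ ‖c' - c‖ * ‖x' - x‖ := by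
    rw [norm_sub_rev c' c]
    exact real_inner_le_norm _ _
  rcases (norm_nonneg (x' - x)).eq_or_lt with h0 | h0
  · rw [← h0, mul_zero]; exact norm_nonneg _
  · refine le_of_mul_le_mul_right ?_ h0
    nlinarith

/-- This is the Lipschitz bound with equal costs, in a box containing both flows. -/
theorem IsOptimal.unique {c x y : EuclideanSpace ℝ links} (hx : IsOptimal links o d F c x)
    (hy : IsOptimal links o d F c y) : y = x := by
  obtain ⟨R, hR⟩ : ∃ R : ℝ, ∀ e, max (x e) (y e) ≤ R := by
    obtain ⟨R, hR⟩ := (finite_range fun e => max (x e) (y e)).bddAbove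
    exact ⟨R, fun e => hR ⟨e, rfl⟩⟩
  obtain ⟨m, hm, h⟩ := exists_lipschitz_of_bounded (o := o) (d := d) hF R
  have h1 := h c c x y hx hy (fun e => (le_max_left _ _).trans (hR e))
    fun e => (le_max_right _ _).trans (hR e)
  rw [sub_self, norm_zero] at h1
  have h2 : ‖y - x‖ ≤ 0 := by
    by_contra! h0
    exact absurd h1 (not_le.2 (mul_pos hm h0))
  exact sub_eq_zero.1 (norm_le_zero_iff.1 h2)

theorem isOptimal_optFlow (hpath : Reachable links o d) {c : EuclideanSpace ℝ links}
    (hc : c ∈ posCosts links) : IsOptimal links o d F c (optFlow links o d F c) := by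
  have h := exists_isOptimal hF hpath hc
  rw [optFlow, dif_pos h]
  exact h.choose_spec

/-- Near `c₀` the costs stay above a common `δ`, and one fixed feasible flow bounds the optimal cost
from above. The optimal flows then share a common bound, and the Lipschitz estimate on bounded
regions applies. -/
theorem exists_lipschitz_optFlow (hpath : Reachable links o d) {c₀ : EuclideanSpace ℝ links}
    (hc₀ : c₀ ∈ posCosts links) : ∃ K ≥ 0, ∃ U ∈ 𝓝 c₀, ∀ c ∈ U, ∀ c' ∈ U,
      ‖optFlow links o d F c' - optFlow links o d F c‖ ≤ K * ‖c' - c‖ := by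
  obtain ⟨x₀, hx₀⟩ := nonempty_feasible hpath
  obtain ⟨δ, hδ, hδc⟩ := exists_pos_lt_of_mem_posCosts hc₀
  set J : EuclideanSpace ℝ links → ℝ := fun c => ∑ e, c e * x₀ e + totalF F x₀ with hJ
  have hJc : Continuous J := by fun_prop
  have hU : ∀ᶠ c in 𝓝 c₀, (∀ e, δ < c e) ∧ J c < J c₀ + 1 := by
    refine Eventually.and (eventually_all.2 fun e => ?_)
      (hJc.continuousAt.eventually (gt_mem_nhds (lt_add_one _)))
    have : Continuous fun c : EuclideanSpace ℝ links => c e := by fun_prop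
    exact this.continuousAt.eventually (lt_mem_nhds (hδc e))
  obtain ⟨m, hm, hlip⟩ := exists_lipschitz_of_bounded (o := o) (d := d) hF ((J c₀ + 1) / δ)
  have hpos : ∀ c : EuclideanSpace ℝ links, (∀ e, δ < c e) → c ∈ posCosts links :=
    fun c h e => hδ.trans (h e)
  have hbd : ∀ c : EuclideanSpace ℝ links, (∀ e, δ < c e) ∧ J c < J c₀ + 1 →
      ∀ e, optFlow links o d F c e ≤ (J c₀ + 1) / δ := by
    rintro c ⟨hc, hcJ⟩ e
    have hopt := isOptimal_optFlow hF hpath (hpos c hc)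
    exact flow_le_of_cost_le hF hδ (fun e => (hc e).le) hopt.2.2
      ((hopt.1 hx₀).trans hcJ.le) e
  refine ⟨m⁻¹, (inv_pos.2 hm).le, _, hU, fun c hc c' hc' => ?_⟩
  rw [inv_mul_eq_div, le_div_iff₀ hm, mul_comm]
  exact hlip c c' _ _ (isOptimal_optFlow hF hpath (hpos c hc.1))
    (isOptimal_optFlow hF hpath (hpos c' hc'.1)) (hbd c hc) (hbd c' hc')

theorem optFlow_sub_isBigO (hpath : Reachable links o d) {c : EuclideanSpace ℝ links}
    (hc : c ∈ posCosts links) :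
    (fun c' => optFlow links o d F c' - optFlow links o d F c) =O[𝓝 c] fun c' => c' - c := by
  obtain ⟨K, -, U, hU, h⟩ := exists_lipschitz_optFlow hF hpath hc
  refine Asymptotics.IsBigO.of_bound K ?_
  filter_upwards [hU] with c' hc'
  exact h c (mem_of_mem_nhds hU) c' hc'

theorem continuousAt_optFlow (hpath : Reachable links o d) {c : EuclideanSpace ℝ links}
    (hc : c ∈ posCosts links) : ContinuousAt (optFlow links o d F) c := by
  have h1 : Tendsto (fun c' : EuclideanSpace ℝ links => c' - c) (𝓝 c) (𝓝 0) := by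
    have : Continuous fun c' : EuclideanSpace ℝ links => c' - c := by fun_prop
    simpa using this.tendsto c
  exact tendsto_sub_nhds_zero_iff.1 ((optFlow_sub_isBigO hF hpath hc).trans_tendsto h1)

end Perturbation

end OptimalFlow

section Regularity

variable {N : Type*} [DecidableEq N] {links : Finset (N × N)} {o d : N} {F : links → ℝ → ℝ}
  (hF : ∀ e, IsPerturbation (F e)) (hpath : Reachable links o d)

include hF hpath

/-! ### The value function -/

theorem isGreatest_valueFn {c : EuclideanSpace ℝ links} (hc : c ∈ posCosts links) :
    IsGreatest ((fun x : EuclideanSpace ℝ links => ∑ e, x e * (-c) e - totalF F x) ''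
      feasible links o d) (valueFn links o d F (-c)) ∧
    valueFn links o d F (-c) = ∑ e, optFlow links o d F c e * (-c) e
      - totalF F (optFlow links o d F c) := by
  have hopt := isOptimal_optFlow hF hpath hc
  have h1 : IsGreatest ((fun x : EuclideanSpace ℝ links => ∑ e, x e * (-c) e - totalF F x) ''
      feasible links o d) (∑ e, optFlow links o d F c e * (-c) e
      - totalF F (optFlow links o d F c)) := by
    refine ⟨⟨_, hopt.2, rfl⟩, ?_⟩
    rintro _ ⟨y, hy, rfl⟩
    have h2 := hopt.1 hy
    simp only [mem_ofPred_eq] at h2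
    have h3 : ∀ z : EuclideanSpace ℝ links, ∑ e, z e * (-c) e = -∑ e, c e * z e := fun z => by
      rw [← Finset.sum_neg_distrib]
      exact Finset.sum_congr rfl fun e _ => by simp [mul_comm]
    simp only [h3]
    linarith
  have h4 : valueFn links o d F (-c) = _ := h1.csSup_eq
  exact ⟨h4 ▸ h1, h4⟩

/-- This is the subgradient inequality: the optimal flow for `c` remains a competitor for `c'`. -/
theorem inner_optFlow_le_valueFn_sub {c c' : EuclideanSpace ℝ links} (hc : c ∈ posCosts links)
    (hc' : c' ∈ posCosts links) :
    inner ℝ (optFlow links o d F c) (-c' - -c) ≤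
      valueFn links o d F (-c') - valueFn links o d F (-c) := by
  have h1 := (isGreatest_valueFn hF hpath hc').1.2
    ⟨_, (isOptimal_optFlow hF hpath hc).2, rfl⟩
  have h2 := (isGreatest_valueFn hF hpath hc).2
  have h3 : inner ℝ (optFlow links o d F c) (-c' - -c) =
      ∑ e, optFlow links o d F c e * (-c') e - ∑ e, optFlow links o d F c e * (-c) e := by
    rw [← Finset.sum_sub_distrib, PiLp.inner_apply]
    exact Finset.sum_congr rfl fun e _ => by simp; ring
  rw [h3, h2]
  linarith

/-- The subgradient inequalities at `-c` and at `v` squeeze the first-order remainder between `0`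
and `⟪x*(-v) - x*(c), v + c⟫`, which is `o(‖v + c‖)` by continuity of `x*`. -/
theorem hasGradientAt_valueFn {c : EuclideanSpace ℝ links} (hc : c ∈ posCosts links) :
    HasGradientAt (valueFn links o d F) (optFlow links o d F c) (-c) := by
  have hneg : Tendsto (fun v : EuclideanSpace ℝ links => -v) (𝓝 (-c)) (𝓝 c) := by
    simpa using (continuous_neg (G := EuclideanSpace ℝ links)).tendsto (-c)
  have hlip : (fun v => optFlow links o d F (-v) - optFlow links o d F c) =o[𝓝 (-c)]
      fun _ => (1 : ℝ) := by
    rw [Asymptotics.isLittleO_one_iff]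
    exact tendsto_sub_nhds_zero_iff.2 ((continuousAt_optFlow hF hpath hc).tendsto.comp hneg)
  have hprod := hlip.norm_left.mul_isBigO
    (Asymptotics.isBigO_refl (fun v : EuclideanSpace ℝ links => ‖v - -c‖) (𝓝 (-c)))
  rw [hasGradientAt_iff_isLittleO]
  refine Asymptotics.IsLittleO.trans_isBigO ((Asymptotics.IsBigO.of_bound 1 ?_).trans_isLittleO
    hprod) (by simpa using (Asymptotics.isBigO_refl _ _).norm_left)
  filter_upwards [hneg.eventually (isOpen_posCosts.mem_nhds hc)] with v hv
  have h1 := inner_optFlow_le_valueFn_sub hF hpath hc hv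
  have h2 := inner_optFlow_le_valueFn_sub hF hpath hv hc
  rw [neg_neg] at h1 h2
  have h3 : inner ℝ (optFlow links o d F (-v)) (-c - v) =
      -inner ℝ (optFlow links o d F c) (v - -c)
        - inner ℝ (optFlow links o d F (-v) - optFlow links o d F c) (v - -c) := by
    rw [inner_sub_left, ← neg_sub v, inner_neg_right]; ring
  have h4 := real_inner_le_norm (optFlow links o d F (-v) - optFlow links o d F c) (v - -c)
  have h5 : 0 ≤ ‖optFlow links o d F (-v) - optFlow links o d F c‖ * ‖v - -c‖ := by positivity
  rw [one_mul, Real.norm_eq_abs, Real.norm_eq_abs, abs_of_nonneg h5, abs_le]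
  constructor <;> linarith

theorem contDiffOn_valueFn :
    ContDiffOn ℝ 1 (valueFn links o d F) {v | -v ∈ posCosts links} := by
  intro v hv
  refine ContDiffAt.contDiffWithinAt (contDiffAt_one_iff.2
    ⟨fun v => InnerProductSpace.toDual ℝ _ (optFlow links o d F (-v)), {v | -v ∈ posCosts links},
      (isOpen_posCosts.preimage continuous_neg).mem_nhds hv, fun w hw => ?_, fun w hw => ?_⟩)
  · refine ContinuousAt.continuousWithinAt ?_
    have h1 : ContinuousAt (fun w => optFlow links o d F (-w)) w :=
      ContinuousAt.comp (f := fun w : EuclideanSpace ℝ links => -w)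
        (continuousAt_optFlow hF hpath hw) continuous_neg.continuousAt
    exact (InnerProductSpace.toDual ℝ (EuclideanSpace ℝ links)).continuous.continuousAt.comp h1
  · have := (hasGradientAt_valueFn hF hpath hw).hasFDerivAt
    rwa [neg_neg] at this

/-! ### Differentiability of the optimal flow off the activation boundary -/

-- The indicator is `0`-`1` valued, so continuity at a point forces it to be locally constant.
omit hF hpath in
theorem eventually_activeIndicator_eq {c : EuclideanSpace ℝ links}
    (hc : c ∈ posCosts links \ activationBoundary links o d F) :
    ∀ᶠ c' in 𝓝 c, activeIndicator (optFlow links o d F c') =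
      activeIndicator (optFlow links o d F c) := by
  have hcont : ContinuousAt (fun c' => activeIndicator (optFlow links o d F c')) c := by
    by_contra h
    exact hc.2 ⟨hc.1, h⟩
  have h1 : ∀ e, ∀ᶠ c' in 𝓝 c, |activeIndicator (optFlow links o d F c') e -
      activeIndicator (optFlow links o d F c) e| < 1 := fun e => by
    have := (continuousAt_pi.1 hcont e).eventually (Metric.ball_mem_nhds _ one_pos)
    simpa [Real.dist_eq] using this
  filter_upwards [eventually_all.2 h1] with c' h
  funext e
  have := h e
  unfold activeIndicator at this ⊢
  split_ifs at this ⊢ <;> simp_all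

omit hF hpath in
theorem mem_diff_activationBoundary_of_eventually_eq {c : EuclideanSpace ℝ links}
    (hc : c ∈ posCosts links) {χ : links → ℝ}
    (h : ∀ᶠ c' in 𝓝 c, activeIndicator (optFlow links o d F c') = χ) :
    c ∈ posCosts links \ activationBoundary links o d F :=
  ⟨hc, fun hb => hb.2 <| continuousAt_const.congr <| h.mono fun _ h => h.symm⟩

section Jacobian

variable [Fintype N]

omit hpath in
/-- Marginal costs at an optimal flow are orthogonal to circulations on active links. -/
theorem IsOptimal.projMatrix_mulVec_marginal {c x : EuclideanSpace ℝ links}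
    (hx : IsOptimal links o d F c x) :
    projMatrix x *ᵥ (fun e => c e + marginal (F e) (x e)) = 0 := by
  have h0 : ∀ w : links → ℝ, 0 ≤ (fun e => c e + marginal (F e) (x e)) ⬝ᵥ (projMatrix x *ᵥ w) := by
    intro w
    refine hx.variational_of_eventually (z := WithLp.toLp 2 (projMatrix x *ᵥ w)) hF
      (eventually_add_smul_mem_feasible hx.2 ?_ fun e he => ?_)
    · rw [WithLp.ofLp_toLp, Matrix.mulVec_mulVec, incidence_mul_projMatrix, Matrix.zero_mulVec]
    · change 0 ≤ (projMatrix x *ᵥ w) e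
      rw [← activeMatrix_mul_projMatrix, ← Matrix.mulVec_mulVec, activeMatrix,
        Matrix.mulVec_diagonal, activeIndicator, he]
      simp
  -- Directions in the range of `P` vanish on inactive links, so both `w` and `-w` are admissible
  -- and the inequality becomes an equality.
  have h1 : ∀ w : links → ℝ, (fun e => c e + marginal (F e) (x e)) ⬝ᵥ (projMatrix x *ᵥ w) = 0 := by
    intro w
    refine le_antisymm ?_ (h0 w)
    have := h0 (-w)
    rwa [Matrix.mulVec_neg, dotProduct_neg, neg_nonneg] at this
  refine dotProduct_eq_zero _ fun w => ?_
  rw [← h1 w, Matrix.dotProduct_mulVec, ← Matrix.mulVec_transpose, projMatrix_transpose]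

theorem neg_jacobianMatrix_posSemidef {c : EuclideanSpace ℝ links} (hc : c ∈ posCosts links) :
    (-jacobianMatrix links o d F c).PosSemidef := by
  rw [jacobianMatrix, neg_neg]
  exact pinv_compression_posSemidef (projMatrix_transpose _)
    (hessF_pos hF (isOptimal_optFlow hF hpath hc).2.2)

theorem jacobianMatrix_isSymm {c : EuclideanSpace ℝ links} (hc : c ∈ posCosts links) :
    (jacobianMatrix links o d F c).IsSymm := by
  have h := (neg_jacobianMatrix_posSemidef hF hpath hc).1
  rw [Matrix.IsHermitian, Matrix.conjTranspose_eq_transpose_of_trivial, Matrix.transpose_neg,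
    neg_inj] at h
  exact h

omit hpath in
/-- Optimal flows with the same active links differ by the linearized response `-Y (c' - c)`,
where `Y = (P ∇²F P)⁺`, up to the linearization error of the marginal costs. -/
theorem IsOptimal.sub_eq {c c' x x' : EuclideanSpace ℝ links} (hx : IsOptimal links o d F c x)
    (hx' : IsOptimal links o d F c' x') (hact : activeIndicator x' = activeIndicator x) :
    x'.ofLp - x.ofLp =
      -(pinv (projMatrix x * hessF F x * projMatrix x) *ᵥ (c'.ofLp - c.ofLp)) -
      pinv (projMatrix x * hessF F x * projMatrix x) *ᵥ (fun e => marginal (F e) (x' e) -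
        marginal (F e) (x e) - (x' e - x e) * derivWithin (marginal (F e)) (Ici 0) (x e)) := by
  have hPt := projMatrix_transpose x
  have hPP := projMatrix_mul_self x
  have hpos := hessF_pos hF hx.2.2
  set Y := pinv (projMatrix x * hessF F x * projMatrix x) with hY
  have hYP : Y * projMatrix x = Y := pinv_compression_mul hPt hPP
  have hYM : Y * (projMatrix x * hessF F x * projMatrix x) = projMatrix x :=
    pinv_mul_compression hPt hPP hpos
  have hz : projMatrix x *ᵥ (x'.ofLp - x.ofLp) = x'.ofLp - x.ofLp := by
    refine projMatrix_mulVec_eq_self x ?_ ?_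
    · rw [Matrix.mulVec_sub, hx'.2.1, hx.2.1, sub_self]
    · funext e
      rw [activeMatrix, Matrix.mulVec_diagonal]
      by_cases he : 0 < x e
      · simp [activeIndicator, he]
      · have h1 : x e = 0 := le_antisymm (not_lt.1 he) (hx.2.2 e)
        have h2 : x' e = 0 := le_antisymm
          (not_lt.1 fun h => he ((activeIndicator_eq_iff.1 hact e).1 h)) (hx'.2.2 e)
        simp [h1, h2]
  -- The difference lies in the range of `P` and `Y = Y P`, so `Y` applied to the Hessian image is
  -- `Y (P ∇²F P)` applied to the difference, which is `P` applied to it.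
  have hYH : Y *ᵥ (hessF F x *ᵥ (x'.ofLp - x.ofLp)) = x'.ofLp - x.ofLp := by
    have h1 : Y *ᵥ (hessF F x *ᵥ (projMatrix x *ᵥ (x'.ofLp - x.ofLp))) = x'.ofLp - x.ofLp := by
      rw [Matrix.mulVec_mulVec, Matrix.mulVec_mulVec, ← hYP, Matrix.mul_assoc Y,
        Matrix.mul_assoc Y, hYM, hz]
    rwa [hz] at h1
  have hx0 : Y *ᵥ (fun e => c e + marginal (F e) (x e)) = 0 := by
    rw [← hYP, ← Matrix.mulVec_mulVec, hx.projMatrix_mulVec_marginal hF, Matrix.mulVec_zero]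
  have hx'0 : Y *ᵥ (fun e => c' e + marginal (F e) (x' e)) = 0 := by
    rw [← hYP, ← Matrix.mulVec_mulVec, ← projMatrix_congr _ hact,
      hx'.projMatrix_mulVec_marginal hF, Matrix.mulVec_zero]
  have hsplit : (fun e => marginal (F e) (x' e) - marginal (F e) (x e) -
      (x' e - x e) * derivWithin (marginal (F e)) (Ici 0) (x e)) =
      (fun e => c' e + marginal (F e) (x' e)) - (fun e => c e + marginal (F e) (x e)) -
        (c'.ofLp - c.ofLp) - hessF F x *ᵥ (x'.ofLp - x.ofLp) := by
    funext e
    simp only [hessF, Pi.sub_apply, Matrix.mulVec_diagonal]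
    ring
  rw [hsplit, Matrix.mulVec_sub Y (_ - _ - _), Matrix.mulVec_sub Y (_ - _) (c'.ofLp - _),
    Matrix.mulVec_sub Y (fun e => c' e + _), hYH, hx0, hx'0]
  abel

/-- `IsOptimal.sub_eq` holds exactly near `c`, where the active links are constant. Its error term
is `o(x' - x)` by differentiability of `F'`, hence `o(c' - c)` by the Lipschitz bound. -/
theorem hasFDerivAt_optFlow {c : EuclideanSpace ℝ links}
    (hc : c ∈ posCosts links \ activationBoundary links o d F) :
    HasFDerivAt (optFlow links o d F)
      (Matrix.toEuclideanCLM (𝕜 := ℝ) (jacobianMatrix links o d F c)) c := by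
  have hopt := isOptimal_optFlow hF hpath hc.1
  have hO := optFlow_sub_isBigO hF hpath hc.1
  set x := optFlow links o d F c with hx
  set Y := pinv (projMatrix x * hessF F x * projMatrix x) with hY
  have hlin : ∀ e, (fun c' => marginal (F e) (optFlow links o d F c' e) - marginal (F e) (x e) -
      (optFlow links o d F c' e - x e) * derivWithin (marginal (F e)) (Ici 0) (x e)) =o[𝓝 c]
      fun c' => c' - c := by
    intro e
    have h1 := ((hF e).hasDerivWithinAt_marginal (hopt.2.2 e)).hasFDerivWithinAt.isLittleO
    have h2 : Tendsto (fun c' => optFlow links o d F c' e) (𝓝 c) (𝓝[Ici 0] (x e)) := by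
      refine tendsto_nhdsWithin_iff.2 ⟨?_, ?_⟩
      · have : Continuous fun y : EuclideanSpace ℝ links => y e := by fun_prop
        exact this.continuousAt.tendsto.comp (continuousAt_optFlow hF hpath hc.1).tendsto
      · filter_upwards [isOpen_posCosts.mem_nhds hc.1] with c' hc'
        exact (isOptimal_optFlow hF hpath hc').2.2 e
    have h3 : (fun c' => optFlow links o d F c' e - x e) =O[𝓝 c] fun c' => c' - c :=
      (Asymptotics.IsBigO.of_norm_le fun c' =>
        PiLp.norm_apply_le (optFlow links o d F c' - x) e).trans hO.norm_left
    simpa [Function.comp_def] using (h1.comp_tendsto h2).trans_isBigO h3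
  refine (hasFDerivWithinAt_univ.1 (hasFDerivWithinAt_euclidean.2 fun i => ?_))
  rw [hasFDerivWithinAt_univ, hasFDerivAt_iff_isLittleO]
  have hsum := Asymptotics.IsLittleO.sum (s := Finset.univ) fun e _ =>
    (hlin e).const_mul_left (-(Y i e))
  refine hsum.congr' ?_ EventuallyEq.rfl
  filter_upwards [eventually_activeIndicator_eq hc, isOpen_posCosts.mem_nhds hc.1] with c' hact hc'
  have h := congrFun (hopt.sub_eq hF (isOptimal_optFlow hF hpath hc') hact) i
  simp only [Pi.sub_apply, Pi.neg_apply] at h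
  rw [h, jacobianMatrix]
  simp only [ContinuousLinearMap.comp_apply, PiLp.proj_apply, Matrix.ofLp_toEuclideanCLM,
    Matrix.neg_mulVec, Pi.neg_apply, WithLp.ofLp_sub]
  simp only [Finset.sum_apply, neg_mul, Finset.sum_neg_distrib]
  simp only [← hx, ← hY, Matrix.mulVec, dotProduct]
  ring

theorem contDiffAt_optFlow {c : EuclideanSpace ℝ links}
    (hc : c ∈ posCosts links \ activationBoundary links o d F) :
    ContDiffAt ℝ 1 (optFlow links o d F) c := by
  obtain ⟨U, hU, hUo, hcU⟩ := eventually_nhds_iff.1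
    ((eventually_activeIndicator_eq hc).and (isOpen_posCosts.mem_nhds hc.1))
  refine contDiffAt_one_iff.2 ⟨fun c' => Matrix.toEuclideanCLM (𝕜 := ℝ)
    (jacobianMatrix links o d F c'), U, hUo.mem_nhds hcU, ?_, fun c' hc' => ?_⟩
  -- On `U` the projection is frozen, so the Jacobian varies only through the Hessian.
  · have hP : ∀ c' ∈ U, jacobianMatrix links o d F c' = -pinv (projMatrix (optFlow links o d F c) *
        hessF F (optFlow links o d F c') * projMatrix (optFlow links o d F c)) := fun c' hc' => by
      rw [jacobianMatrix, projMatrix_congr _ (hU c' hc').1]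
    have hJ : ContinuousOn (jacobianMatrix links o d F) U := by
      refine ContinuousOn.congr (ContinuousOn.neg ?_) hP
      refine continuousOn_pinv_compression (projMatrix_transpose _) (projMatrix_mul_self _)
        (continuousOn_pi.2 fun e => ?_)
        fun c' hc' => hessF_pos hF (isOptimal_optFlow hF hpath (hU c' hc').2).2.2
      refine (hF e).continuousOn_deriv_marginal.comp (fun c' hc' => ?_)
        fun c' hc' => (isOptimal_optFlow hF hpath (hU c' hc').2).2.2 e
      have : Continuous fun y : EuclideanSpace ℝ links => y e := by fun_prop
      exact (this.continuousAt.comp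
        (continuousAt_optFlow hF hpath (hU c' hc').2)).continuousWithinAt
    have hlin : Continuous fun A : Matrix links links ℝ => Matrix.toEuclideanCLM (𝕜 := ℝ) A :=
      LinearMap.continuous_of_finiteDimensional
        (IsLinearMap.mk' (Matrix.toEuclideanCLM (n := links) (𝕜 := ℝ)) ⟨map_add _, map_smul _⟩)
    exact hlin.comp_continuousOn hJ
  · exact hasFDerivAt_optFlow hF hpath (mem_diff_activationBoundary_of_eventually_eq (hU c' hc').2
      ((hUo.eventually_mem hc').mono fun c'' hc'' => (hU c'' hc'').1))

end Jacobian

/-! ### The activation boundary is a null set -/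

/-- Raising the cost of an unused link does not change the optimal flow. -/
theorem optFlow_add_single {c : EuclideanSpace ℝ links} (hc : c ∈ posCosts links) {e : links}
    (he : optFlow links o d F c e = 0) {t : ℝ} (ht : 0 ≤ t) :
    optFlow links o d F (c + EuclideanSpace.single e t) = optFlow links o d F c := by
  have hopt := isOptimal_optFlow hF hpath hc
  have hs : ∀ y : EuclideanSpace ℝ links,
      ∑ i, (c + EuclideanSpace.single e t) i * y i = ∑ i, c i * y i + t * y e := fun y => by
    simp [add_mul, Finset.sum_add_distrib]
  have hc' : c + EuclideanSpace.single e t ∈ posCosts links := fun i => by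
    refine add_pos_of_pos_of_nonneg (hc i) ?_
    change 0 ≤ (EuclideanSpace.single e t : EuclideanSpace ℝ links) i
    rw [PiLp.single_apply]
    split_ifs <;> [exact ht; exact le_rfl]
  refine (IsOptimal.unique hF (isOptimal_optFlow hF hpath hc') ⟨fun y hy => ?_, hopt.2⟩).symm
  have h1 := hopt.1 hy
  simp only [mem_ofPred_eq] at h1 ⊢
  rw [hs, hs, he]
  linarith [mul_nonneg ht (hy.2 e)]

/-- After raising the cost of an unused link, the link stays unused in a neighborhood. -/
theorem eventually_optFlow_add_single_eq_zero {c : EuclideanSpace ℝ links}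
    (hc : c ∈ posCosts links) {e : links} (he : optFlow links o d F c e = 0) {t : ℝ} (ht : 0 < t) :
    ∀ᶠ c' in 𝓝 (c + EuclideanSpace.single e t), optFlow links o d F c' e = 0 := by
  set c₁ := c + EuclideanSpace.single e t with hc₁
  have hc₁c : ∀ i, c₁ i = c i + if i = e then t else 0 := fun i => by
    rw [hc₁, PiLp.add_apply, PiLp.single_apply]
  have hc₁pos : c₁ ∈ posCosts links := fun i => by
    rw [hc₁c]
    exact add_pos_of_pos_of_nonneg (hc i) (by split_ifs <;> [exact ht.le; exact le_rfl])
  set x := optFlow links o d F c with hx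
  have hx₁ : optFlow links o d F c₁ = x := optFlow_add_single hF hpath hc he ht.le
  have hopt := isOptimal_optFlow hF hpath hc
  -- it suffices to treat one support set at a time
  suffices H : ∀ S : Set links, ∀ᶠ c' in 𝓝 c₁,
      {i | 0 < optFlow links o d F c' i} = S → optFlow links o d F c' e = 0 from
    (eventually_all.2 H).mono fun c' h => h _ rfl
  intro S
  by_contra hfreq
  have hfreq' : ∃ᶠ c' in 𝓝 c₁, c' ∈ posCosts links ∧
      {i | 0 < optFlow links o d F c' i} = S ∧ optFlow links o d F c' e ≠ 0 := by
    refine ((not_eventually.1 hfreq).and_eventually (isOpen_posCosts.mem_nhds hc₁pos)).mono ?_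
    rintro c' ⟨h1, h2⟩
    rw [Classical.not_imp] at h1
    exact ⟨h2, h1⟩
  obtain ⟨c₀, hc₀, hS₀, hne₀⟩ := hfreq'.exists
  -- A reference flow with support `S` that uses `e`. It serves for every nearby cost whose optimal
  -- flow has the same support.
  set χ := optFlow links o d F c₀ with hχ
  have hχf := (isOptimal_optFlow hF hpath hc₀).2
  set Φ : EuclideanSpace ℝ links → ℝ := fun c' =>
    ∑ i, (c' i + marginal (F i) (optFlow links o d F c' i)) * (x i - χ i) with hΦ
  have hΦcont : ContinuousWithinAt Φ (posCosts links) c₁ := by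
    have hmem : ∀ i, MapsTo (fun c' => optFlow links o d F c' i) (posCosts links) (Ici 0) :=
      fun i c' hc' => (isOptimal_optFlow hF hpath hc').2.2 i
    refine tendsto_finsetSum _ fun i _ => ContinuousWithinAt.mul (ContinuousWithinAt.add ?_ ?_)
      continuousWithinAt_const
    · have : Continuous fun y : EuclideanSpace ℝ links => y i := by fun_prop
      exact this.continuousWithinAt
    · refine ContinuousWithinAt.comp (t := Ici 0) (g := marginal (F i))
        (f := fun c' => optFlow links o d F c' i)
        ((hF i).continuousOn_marginal _ (hmem i hc₁pos)) ?_ (hmem i)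
      have : Continuous fun y : EuclideanSpace ℝ links => y i := by fun_prop
      exact (this.continuousAt.comp
        (continuousAt_optFlow hF hpath hc₁pos)).continuousWithinAt
  -- At an optimal flow with support `S` the direction `x - χ` is admissible: off `S` the flow `χ`
  -- vanishes, so the direction is nonnegative there. Continuity then carries the sign of `Φ` to
  -- `c₁`.
  have hnonneg : ∃ᶠ c' in 𝓝 c₁, c' ∈ posCosts links ∧ 0 ≤ Φ c' := by
    refine hfreq'.mono ?_
    rintro c' ⟨hc', hS, -⟩
    refine ⟨hc', ?_⟩
    have hopt' := isOptimal_optFlow hF hpath hc'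
    refine hopt'.variational_of_eventually (z := x - χ) hF
      (eventually_add_smul_mem_feasible hopt'.2 ?_ fun i hi => ?_)
    · rw [WithLp.ofLp_sub, Matrix.mulVec_sub, hopt.2.1, hχf.1, sub_self]
    · have h1 : i ∉ {i | 0 < χ i} := by
        rw [hS₀, ← hS]
        simp [hi]
      have h2 : χ i = 0 := le_antisymm (not_lt.1 h1) (hχf.2 i)
      rw [PiLp.sub_apply, h2, sub_zero]
      exact hopt.2.2 i
  have h1 : 0 ≤ Φ c₁ := by
    by_contra! hlt
    have hev : ∀ᶠ c' in 𝓝[posCosts links] c₁, Φ c' < 0 := hΦcont.eventually (gt_mem_nhds hlt)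
    rw [eventually_nhdsWithin_iff] at hev
    obtain ⟨c', ⟨hc', h2⟩, h3⟩ := (hnonneg.and_eventually hev).exists
    exact absurd (h3 hc') (not_lt.2 h2)
  have h2 := hopt.variational hF hχf
  -- The sum is nonnegative by optimality of `x` at `c`. The raised cost contributes `-t * χ e < 0`,
  -- since `x` does not use `e` and `χ` does, contradicting `0 ≤ Φ c₁`.
  have h3 : Φ c₁ = -(∑ i, (c i + marginal (F i) (x i)) * (χ i - x i)) - t * χ e := by
    have : ∀ i, (c₁ i + marginal (F i) (optFlow links o d F c₁ i)) * (x i - χ i) =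
        -((c i + marginal (F i) (x i)) * (χ i - x i)) + if i = e then t * (x i - χ i) else 0 := by
      intro i
      rw [hx₁, hc₁c]
      split_ifs <;> ring
    simp only [hΦ, this]
    rw [Finset.sum_add_distrib, Finset.sum_neg_distrib, Finset.sum_ite_eq' Finset.univ e]
    simp [he]
    ring
  have h4 : 0 < χ e := (hχf.2 e).lt_of_ne' hne₀
  linarith [mul_pos ht h4]

omit hF hpath in
/-- The cost vectors at which the unused link `e` becomes active under small perturbations. -/
def linkBoundary (links : Finset (N × N)) (o d : N) (F : links → ℝ → ℝ) (e : links) :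
    Set (EuclideanSpace ℝ links) :=
  {c ∈ posCosts links | optFlow links o d F c e = 0 ∧
    ∃ᶠ c' in 𝓝 c, optFlow links o d F c' e ≠ 0}

/-- Active links stay active by continuity of the flow, so the indicator can only jump at a link
that is unused at `c`. -/
theorem activationBoundary_subset :
    activationBoundary links o d F ⊆ ⋃ e, linkBoundary links o d F e := by
  intro c hc
  by_contra hnot
  rw [mem_iUnion, not_exists] at hnot
  refine (mem_diff_activationBoundary_of_eventually_eq hc.1
    (χ := activeIndicator (optFlow links o d F c)) ?_).2 hc
  have hopt := isOptimal_optFlow hF hpath hc.1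
  have h1 : ∀ e, ∀ᶠ c' in 𝓝 c, 0 < optFlow links o d F c' e ↔ 0 < optFlow links o d F c e := by
    intro e
    rcases (hopt.2.2 e).eq_or_lt with h0 | h0
    · have h2 : ¬∃ᶠ c' in 𝓝 c, optFlow links o d F c' e ≠ 0 := fun h =>
        hnot e ⟨hc.1, h0.symm, h⟩
      filter_upwards [not_frequently.1 h2] with c' hc'
      rw [not_not.1 hc', ← h0]
    · have : Continuous fun y : EuclideanSpace ℝ links => y e := by fun_prop
      filter_upwards [(this.continuousAt.comp (continuousAt_optFlow hF hpath hc.1)).eventually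
        (lt_mem_nhds h0)] with c' hc'
      exact iff_of_true hc' h0
  exact (eventually_all.2 h1).mono fun c' h => activeIndicator_eq_iff.2 h

/-- The frequently-nonzero condition is membership in a closure, and the vanishing condition is
relatively closed in the open set of positive costs. -/
theorem measurableSet_linkBoundary (e : links) :
    MeasurableSet (linkBoundary links o d F e) := by
  have hcont : ContinuousOn (fun c => optFlow links o d F c e) (posCosts links) := fun c hc => by
    have : Continuous fun y : EuclideanSpace ℝ links => y e := by fun_prop
    exact (this.continuousAt.comp (continuousAt_optFlow hF hpath hc)).continuousWithinAt
  have h1 : linkBoundary links o d F e =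
      (posCosts links \ (posCosts links ∩ (fun c => optFlow links o d F c e) ⁻¹' {0}ᶜ)) ∩
        closure {c | optFlow links o d F c e ≠ 0} := by
    ext c
    rw [mem_inter_iff, mem_closure_iff_frequently]
    simp only [linkBoundary, mem_ofPred_eq, Set.mem_sdiff, mem_inter_iff, mem_preimage, mem_compl_iff,
      mem_singleton_iff]
    tauto
  rw [h1]
  exact (isOpen_posCosts.measurableSet.diff
    (hcont.isOpen_inter_preimage isOpen_posCosts isOpen_compl_singleton).measurableSet).inter
      isClosed_closure.measurableSet

open scoped Pointwise in
-- The set meets each line parallel to the `e`-axis at most once. Its translates by the bounded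
-- sequence of distinct vectors `u n` on that axis are thus pairwise disjoint, and infinitely many
-- disjoint translates within a bounded range force measure zero.
theorem volume_linkBoundary (e : links) : volume (linkBoundary links o d F e) = 0 := by
  set u : ℕ → EuclideanSpace ℝ links := fun n => EuclideanSpace.single e (1 / ((n : ℝ) + 1)) with hu
  have hline : ∀ c ∈ linkBoundary links o d F e, ∀ t > 0,
      c + EuclideanSpace.single e t ∉ linkBoundary links o d F e := fun c hc t ht hct =>
    hct.2.2 ((eventually_optFlow_add_single_eq_zero hF hpath hc.1 hc.2.1 ht).mono
      fun _ h => not_not.2 h)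
  have hlt : ∀ {m n : ℕ}, m < n →
      Disjoint (({u m} : Set _) + linkBoundary links o d F e) (({u n} : Set _) + linkBoundary links o d F e) := by
    intro m n hmn
    rw [Set.disjoint_left]
    rintro _ ⟨_, rfl, a, ha, rfl⟩ ⟨_, rfl, b, hb, hab⟩
    have ht : (0 : ℝ) < 1 / ((m : ℝ) + 1) - 1 / ((n : ℝ) + 1) :=
      sub_pos.2 (Nat.one_div_lt_one_div hmn)
    -- A common point of the two translates would put both `a` and its shift `b` by `u m - u n`, a
    -- positive step along the axis, in the set.
    refine hline a ha _ ht ?_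
    have : a + EuclideanSpace.single e (1 / ((m : ℝ) + 1) - 1 / ((n : ℝ) + 1)) = b := by
      have h1 : (EuclideanSpace.single e (1 / ((m : ℝ) + 1) - 1 / ((n : ℝ) + 1)) :
          EuclideanSpace ℝ links) = u m - u n := by
        ext i
        simp only [hu, PiLp.sub_apply, PiLp.single_apply]
        split_ifs <;> simp
      have h2 : u n + b = u m + a := hab
      rw [h1, eq_sub_of_add_eq' h2]
      abel
    rwa [this]
  refine Measure.addHaar_eq_zero_of_disjoint_translates volume u ?_ ?_
    (measurableSet_linkBoundary hF hpath e)
  · refine isBounded_iff_forall_norm_le.2 ⟨1, ?_⟩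
    rintro _ ⟨n, rfl⟩
    have h0 : (0 : ℝ) < (n : ℝ) + 1 := by positivity
    rw [hu, PiLp.norm_single, Real.norm_eq_abs, abs_of_pos (by positivity),
      div_le_one h0]
    simp
  · intro m n hmn
    rcases hmn.lt_or_gt with h | h
    · exact hlt h
    · exact (hlt h).symm

theorem volume_activationBoundary : volume (activationBoundary links o d F) = 0 :=
  measure_mono_null (activationBoundary_subset hF hpath)
    (measure_iUnion_null fun e => volume_linkBoundary hF hpath e)

end Regularity

end PURC

end

theorem theorem1 {N : Type*} [Fintype N] [DecidableEq N] (links : Finset (N × N)) (o d : N)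
    (hpath : PURC.Reachable links o d)
    (F : links → ℝ → ℝ) (hF : ∀ e, PURC.IsPerturbation (F e)) :
    -- the maximum defining the value function is attained, by a unique optimal flow `x*(c)`
    (∀ c ∈ PURC.posCosts links,
      PURC.IsOptimal links o d F c (PURC.optFlow links o d F c) ∧
      (∀ x, PURC.IsOptimal links o d F c x → x = PURC.optFlow links o d F c) ∧
      IsGreatest ((fun x : EuclideanSpace ℝ links =>
        ∑ e, x e * (-c) e - PURC.totalF F x) '' PURC.feasible links o d)
        (PURC.valueFn links o d F (-c))) ∧
    -- the value function is continuously differentiable with `∇W(-c) = x*(c)`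
    ContDiffOn ℝ 1 (PURC.valueFn links o d F) {v | -v ∈ PURC.posCosts links} ∧
    (∀ c ∈ PURC.posCosts links,
      HasGradientAt (PURC.valueFn links o d F) (PURC.optFlow links o d F c) (-c)) ∧
    ContinuousOn (PURC.optFlow links o d F) (PURC.posCosts links) ∧
    -- `x*` is continuously differentiable off the activation boundary, with the stated Jacobian
    (∀ c ∈ PURC.posCosts links \ PURC.activationBoundary links o d F,
      ContDiffAt ℝ 1 (PURC.optFlow links o d F) c ∧
      HasFDerivAt (PURC.optFlow links o d F)
        (Matrix.toEuclideanCLM (𝕜 := ℝ) (PURC.jacobianMatrix links o d F c)) c ∧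
      (PURC.jacobianMatrix links o d F c).IsSymm ∧
      (-PURC.jacobianMatrix links o d F c).PosSemidef) ∧
    -- the activation boundary is Lebesgue null
    MeasureTheory.volume (PURC.activationBoundary links o d F) = 0 := by
  exact ⟨fun c hc => ⟨PURC.isOptimal_optFlow hF hpath hc,
      fun _ hx => PURC.IsOptimal.unique hF (PURC.isOptimal_optFlow hF hpath hc) hx,
      (PURC.isGreatest_valueFn hF hpath hc).1⟩,
    PURC.contDiffOn_valueFn hF hpath,
    fun _ hc => PURC.hasGradientAt_valueFn hF hpath hc,
    fun _ hc => (PURC.continuousAt_optFlow hF hpath hc).continuousWithinAt,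
    fun _ hc => ⟨PURC.contDiffAt_optFlow hF hpath hc, PURC.hasFDerivAt_optFlow hF hpath hc,
      PURC.jacobianMatrix_isSymm hF hpath hc.1,
      PURC.neg_jacobianMatrix_posSemidef hF hpath hc.1⟩,
    PURC.volume_activationBoundary hF hpath⟩
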